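/- **Conventions.** Let $\mathbb H$ be the upper half-plane, $z=x+iy\in\mathbb H$, $q=e^{2\pi i z}$. For an integer $w$, $N\ge 1$ and a Dirichlet character $\chi$ mod $N$, let $$\Delta_w=y^2\left(\tfrac{\partial^2}{\partial x^2}+\tfrac{\partial^2}{\partial y^2}\right)-iwy\left(\tfrac{\partial}{\partial x}+i\tfrac{\partial}{\partial y}\right),\qquad \xi_w f=2iy^w\,\overline{\partial_{\bar z}f},$$ and let $H_w(N,\chi)$ be the space of real-analytic $F:\mathbb H\to\mathbb C$ with $F(\gamma z)=\chi(d)(cz+d)^wF(z)$ for all $\gamma=\begin{pmatrix}a&b\\c&d\end{pmatrix}\in\Gamma_0(N)$, with $\Delta_wF=0$, with at most linear exponential growth at the cusps, and such that $\xi_wF$ (of weight $2-w$) is holomorphic at every cusp. Put $\beta_w(n,y)=\int_y^\infty e^{-4\pi nu}u^{-w}\,du$ for $n>0$, $\beta_w(0,y)=(w-1)^{-1}y^{1-w}$ for $w\neq 1$, and $\beta_1(0,y)=-\log y$. If $F\in H_w(N,\chi)$ has the expansion $$F(z)=\sum_{n\ge n_0}c^+(n)q^n-\sum_{n\ge 0}\overline{c(n)}\,\beta_w(n,y)q^{-n},$$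 then $\sum_{n\ge n_0}c^+(n)q^n$ is called a mock modular form of weight $w$, level $N$ and character $\chi$ with shadow $\xi_wF$. For a positive integer $N$ let $\mathbf 1_N$ be the trivial Dirichlet character mod $N$. For integers $L,M,n\ge 1$ let $$\sigma_1^{\mathbf 1_L,\mathbf 1_M}(n)=\sum_{c\mid n}\mathbf 1_L\!\left(\tfrac nc\right)c\sum_{d\mid\gcd(M,c)}d\,\mu\!\left(\tfrac Md\right),$$ and $\sigma_1^{\mathbf 1_L,\mathbf 1_M}(x)=0$ if $x$ is not a positive integer. Let $C_2(\mathbf 1_L,\mathbf 1_M)=\sum_{m\ge1}\mathbf 1_M(m)m^{-2}$ if $L=1$ and $C_2(\mathbf 1_L,\mathbf 1_M)=0$ if $L>1$, and let $$E_2^{\mathbf 1_L,\mathbf 1_M}(z)=C_2(\mathbf 1_L,\mathbf 1_M)-\frac{\pi}{2My}\prod_{p\mid M}(1-p^{-1})\prod_{p\mid L}(1-p^{-1})-\frac{4\pi^2}{M^2}\sum_{n=1}^\infty\sigma_1^{\mathbf 1_L,\mathbf 1_M}(n)q^n .$$ For an integer $t\ge1$ let $E_2^{\mathbf 1_L,\mathbf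 1_M,t}(z)=E_2^{\mathbf 1_L,\mathbf 1_M}(z)-tE_2^{\mathbf 1_L,\mathbf 1_M}(tz)$. **Theorem 1.2.** Let $L,M,t\ge 1$ be integers. Put $$c_0^+(0)=\frac{\pi\log t}{M}\prod_{p\mid L}(1-p^{-1})\prod_{p\mid M}(1-p^{-1}),$$ and for $n>0$ $$c_0^+(n)=\frac{\pi}{M^2}\,n^{-1}\left(\sigma_1^{\mathbf 1_L,\mathbf 1_M}(n)-t\,\sigma_1^{\mathbf 1_L,\mathbf 1_M}\!\left(\tfrac nt\right)\right).$$ Then the series $\sum_{n=0}^\infty c_0^+(n)q^n$ converges on $\mathbb H$ and defines a mock modular form of weight $0$, level $tLM$ and trivial character, with shadow $E_2^{\mathbf 1_L,\mathbf 1_M,t}(z)$. -/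

import Mathlib

open scoped UpperHalfPlane ModularForm MatrixGroups ComplexConjugate

noncomputable section

namespace MockEis

/-! ### Differential operators on functions on the upper half-plane -/

/-- `∂/∂x` of a function on `ℂ = ℝ²`, with `z = x + iy`. -/
def dx (g : ℂ → ℂ) (z : ℂ) : ℂ := fderiv ℝ g z 1

/-- `∂/∂y` of a function on `ℂ = ℝ²`, with `z = x + iy`. -/
def dy (g : ℂ → ℂ) (z : ℂ) : ℂ := fderiv ℝ g z Complex.I

/-- A function on `ℍ`, as a function on `ℂ` (only its values at points with positive imaginary
part, where it agrees with `f`, are ever used). -/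
def ext (f : ℍ → ℂ) : ℂ → ℂ := fun z => f (UpperHalfPlane.ofComplex z)

/-- The weight `w` hyperbolic Laplacian
`Δ_w = y² (∂²/∂x² + ∂²/∂y²) - i w y (∂/∂x + i ∂/∂y)`. -/
def hypLaplacian (w : ℤ) (f : ℍ → ℂ) (z : ℍ) : ℂ :=
  (z.im : ℂ) ^ 2 * (dx (dx (ext f)) z + dy (dy (ext f)) z)
    - Complex.I * w * z.im * (dx (ext f) z + Complex.I * dy (ext f) z)

/-- The operator `∂/∂z̄ = (∂/∂x + i ∂/∂y) / 2`. -/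
def dzbar (f : ℍ → ℂ) (z : ℍ) : ℂ :=
  (1 / 2 : ℂ) * (dx (ext f) z + Complex.I * dy (ext f) z)

/-- The operator `ξ_w f = 2 i y^w · conj (∂f/∂z̄)`. -/
def xi (w : ℤ) (f : ℍ → ℂ) (z : ℍ) : ℂ :=
  2 * Complex.I * (z.im : ℂ) ^ w * conj (dzbar f z)

/-! ### Harmonic Maass forms and mock modular forms -/

/-- `f (γ z) = χ(d) (c z + d)^w f(z)` for all `γ = (a b; c d) ∈ Γ₀(N)`. -/
def TransformsLike (w : ℤ) (N : ℕ) (χ : DirichletCharacter ℂ N) (f : ℍ → ℂ) : Prop :=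
  ∀ γ : SL(2, ℤ), γ ∈ CongruenceSubgroup.Gamma0 N → ∀ z : ℍ,
    f (γ • z) = χ ((γ 1 1 : ℤ) : ZMod N)
      * ((γ 1 0 : ℤ) * (z : ℂ) + ((γ 1 1 : ℤ) : ℂ)) ^ w * f z

/-- At most linear exponential growth at every cusp: for every `γ ∈ SL₂(ℤ)` there is a constant
`A` with `(f|_w γ)(z) = O(e^{A y})` as `y → ∞`, uniformly in `x`. -/
def HasLinearExpGrowthAtCusps (w : ℤ) (f : ℍ → ℂ) : Prop :=
  ∀ γ : SL(2, ℤ), ∃ A : ℝ,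
    (f ∣[w] γ) =O[UpperHalfPlane.atImInfty] fun z : ℍ => Real.exp (A * z.im)

/-- Holomorphy at every cusp of a weight `w` (holomorphic) modular function: every translate
`f|_w γ`, `γ ∈ SL₂(ℤ)`, is bounded as `y → ∞`. -/
def IsHolomorphicAtCusps (w : ℤ) (f : ℍ → ℂ) : Prop :=
  ∀ γ : SL(2, ℤ), UpperHalfPlane.IsBoundedAtImInfty (f ∣[w] γ)

/-- The space `H_w(N, χ)` of weakly harmonic Maass forms of weight `w`, level `N` and character
`χ` whose image under `ξ_w` is holomorphic at every cusp. -/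
structure IsHarmonicMaassForm (w : ℤ) (N : ℕ) (χ : DirichletCharacter ℂ N) (F : ℍ → ℂ) :
    Prop where
  analytic : AnalyticOnNhd ℝ (ext F) {z : ℂ | 0 < z.im}
  transforms : TransformsLike w N χ F
  harmonic : ∀ z, hypLaplacian w F z = 0
  growth : HasLinearExpGrowthAtCusps w F
  xi_holomorphic : IsHolomorphicAtCusps (2 - w) (xi w F)

/-- `q = e^{2πiz}`. -/
def q (z : ℍ) : ℂ := Complex.exp (2 * Real.pi * Complex.I * z)

/-- The functions `β_w(n, y)`: `∫_y^∞ e^{-4πnu} u^{-w} du` for `n > 0`; for `n = 0`,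
`(w - 1)⁻¹ y^{1-w}` if `w ≠ 1` and `-log y` if `w = 1`. -/
def beta (w : ℤ) (n : ℕ) (y : ℝ) : ℝ :=
  if n = 0 then
    if w = 1 then -Real.log y else ((w : ℝ) - 1)⁻¹ * y ^ (1 - w)
  else ∫ u in Set.Ioi y, Real.exp (-4 * Real.pi * n * u) * u ^ (-w)

/-- `h` is the holomorphic part of `F`: there are `n₀ ∈ ℤ` and coefficients `c⁺`, `c` with
`F(z) = ∑_{n ≥ n₀} c⁺(n) q^n - ∑_{n ≥ 0} conj(c(n)) β_w(n, y) q^{-n}` and `h` is the first sum.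
Here `a n` is `c⁺(n₀ + n)`. -/
def IsHolomorphicPart (w : ℤ) (F h : ℍ → ℂ) : Prop :=
  ∃ (n₀ : ℤ) (a c : ℕ → ℂ), ∀ z : ℍ,
    HasSum (fun n : ℕ => a n * q z ^ (n₀ + n)) (h z) ∧
    HasSum (fun n : ℕ => conj (c n) * (beta w n z.im : ℂ) * q z ^ (-(n : ℤ))) (h z - F z)

/-- `h` is a mock modular form of weight `w`, level `N` and character `χ` with shadow `g`: it is
the holomorphic part of some `F ∈ H_w(N, χ)` with `ξ_w F = g`. -/
def IsMockModularForm (w : ℤ) (N : ℕ) (χ : DirichletCharacter ℂ N) (h g : ℍ → ℂ) : Prop :=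
  ∃ F : ℍ → ℂ, IsHarmonicMaassForm w N χ F ∧ IsHolomorphicPart w F h ∧ ∀ z, xi w F z = g z

/-! ### The Eisenstein series and the coefficients -/

/-- `σ_j^{ψ,ϱ}(n) = ∑_{c ∣ n} ψ(n/c) c^j ∑_{d ∣ gcd(ℓ,c)} d μ(ℓ/d) conj(ϱ⁰(ℓ/d)) ϱ⁰(c/d)`,
where `ϱ⁰` is the primitive character inducing `ϱ` and `ℓ = M / cond(ϱ)`. -/
def sigma (j : ℕ) {L M : ℕ} (ψ : DirichletCharacter ℂ L) (ϱ : DirichletCharacter ℂ M)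
    (n : ℕ) : ℂ :=
  ∑ c ∈ n.divisors, ψ ((n / c : ℕ) : ZMod L) * (c : ℂ) ^ j *
    ∑ d ∈ (Nat.gcd (M / ϱ.conductor) c).divisors,
      (d : ℂ) * (ArithmeticFunction.moebius (M / ϱ.conductor / d) : ℂ)
        * conj (ϱ.primitiveCharacter ((M / ϱ.conductor / d : ℕ) : ZMod ϱ.conductor))
        * ϱ.primitiveCharacter ((c / d : ℕ) : ZMod ϱ.conductor)

/-- `σ_1^{1_L,1_M}(n)` for the trivial characters mod `L` and mod `M`. -/
def sigmaOne (L M n : ℕ) : ℂ :=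
  sigma 1 (1 : DirichletCharacter ℂ L) (1 : DirichletCharacter ℂ M) n

/-- `∏_{p ∣ N} (1 - p⁻¹)`. -/
def eulerProd (N : ℕ) : ℝ := ∏ p ∈ N.primeFactors, (1 - (p : ℝ)⁻¹)

/-- The constant `C_2(1_L, 1_M)`: `L(2, 1_M)` if `L = 1`, and `0` otherwise. -/
def constC2 (L M : ℕ) : ℂ :=
  if L = 1 then LSeries (fun n => (1 : DirichletCharacter ℂ M) (n : ZMod M)) 2 else 0

/-- The (non-holomorphic) Eisenstein series
`E_2^{1_L,1_M}(z) = C_2(1_L,1_M) - π/(2My) ∏_{p∣M}(1-p⁻¹) ∏_{p∣L}(1-p⁻¹)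
  - (4π²/M²) ∑_{n ≥ 1} σ_1^{1_L,1_M}(n) q^n`, for `Im z > 0`. -/
def E2 (L M : ℕ) (z : ℂ) : ℂ :=
  constC2 L M - (Real.pi / (2 * M * z.im) * eulerProd M * eulerProd L : ℝ)
    - 4 * Real.pi ^ 2 / M ^ 2 *
      ∑' n : ℕ, sigmaOne L M (n + 1) * Complex.exp (2 * Real.pi * Complex.I * z) ^ (n + 1)

/-- `E_2^{1_L,1_M,t}(z) = E_2^{1_L,1_M}(z) - t E_2^{1_L,1_M}(t z)`. -/
def E2t (L M t : ℕ) (z : ℍ) : ℂ := E2 L M z - t * E2 L M (t * z)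

/-- The coefficients `c_0^+(n, t, 1_L, 1_M)`; by convention `σ(n/t) = 0` if `t ∤ n`. -/
def mockCoeff (L M t : ℕ) (n : ℕ) : ℂ :=
  if n = 0 then (Real.pi * Real.log t / M * eulerProd L * eulerProd M : ℝ)
  else Real.pi / M ^ 2 * (n : ℂ)⁻¹ *
    (sigmaOne L M n - t * (if t ∣ n then sigmaOne L M (n / t) else 0))

end MockEis

end

open scoped UpperHalfPlane ModularForm MatrixGroups ComplexConjugate

noncomputable section

/-! The proof rests on the Kronecker limit formula. Möbius inversion writes `sigmaOne L M n` as a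
combination, over `l ∣ L` and `d ∣ M`, of `σ₁(n / (l d))`, so everything reduces to dilates `z ↦ s
z` of level one objects (`sigmaOne_eq_sum_weight`, `constC2_eq`).

Let `J = ∑_{n ≥ 1} c₀⁺(n) qⁿ`. The Maass form is `F = c₀⁺(0) + C y + J + conj J` with `C = (1 - t)
C₂(1_L, 1_M)`. In weight 0 the Laplacian is `y²` times the Euclidean one, so `F` is harmonic, and
`ξ₀ F = 2 i J' + conj C`. This is the required Eisenstein series, since its two `1/y` terms cancel
(`xi_maassForm`).

Invariance of `F` is the main point. The series `∑ σ₁(n) n⁻¹ qⁿ` is, up to a linear term and a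
constant, `-log η`, so `F` is a constant plus a combination of differences `φ(t s z) - φ(s z)`,
where `φ = log (|η|²⁴ y⁶)` is `SL₂(ℤ)`-invariant (`exists_maassForm_eq`). Each dilate is invariant
under `Γ₀(t L M)` because `s` and `t s` divide the level.

At the cusps, `diag(s, 1) γ = γ' (g b; 0 e)` with `γ'` in `SL₂(ℤ)` moves every estimate to `i∞`. It
is applied to `φ` for the growth of `F`, and to `E₂ - 3/(π y)` for the holomorphy of `ξ₀ F`. -/

namespace MockEis


/-! ### Divisor sums and the reduction to level one -/

open ArithmeticFunction in
/-- The trivial character modulo `N` is the divisor sum of the Möbius function over `gcd(N, n)`. -/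
lemma one_apply_eq_sum_moebius {N : ℕ} (hN : N ≠ 0) (n : ℕ) :
    (1 : DirichletCharacter ℂ N) (n : ZMod N)
      = ∑ d ∈ N.divisors, if d ∣ n then (moebius d : ℂ) else 0 := by
  have h1 : N.divisors.filter (· ∣ n) = (N.gcd n).divisors := by
    ext d
    simp [Nat.dvd_gcd_iff, hN]
  rw [← Finset.sum_filter, h1, ← Int.cast_sum]
  have h2 : ∑ d ∈ (N.gcd n).divisors, moebius d = (moebius * (zeta : ArithmeticFunction ℤ)) (N.gcd n) := by
    rw [coe_mul_zeta_apply]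
  rw [h2, moebius_mul_coe_zeta, one_apply]
  by_cases hc : N.gcd n = 1
  · have : IsUnit (n : ZMod N) := (ZMod.isUnit_iff_coprime n N).2 (Nat.Coprime.symm hc)
    simp [hc, MulChar.one_apply this]
  · have : ¬ IsUnit (n : ZMod N) := fun h => hc (((ZMod.isUnit_iff_coprime n N).1 h).symm)
    simp [hc, MulChar.map_nonunit _ this]

/-- Modulo 1 every residue, 0 included, is the unit. This removes the primitive character from
`sigma`, as the trivial character has conductor 1. -/
lemma dirichletCharacter_apply_of_eq_one {n : ℕ} (hn : n = 1) (χ : DirichletCharacter ℂ n)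
    (x : ZMod n) : χ x = 1 := by
  subst hn
  rw [Subsingleton.elim x 1, map_one]

lemma sigmaOne_eq {L M : ℕ} (hM : M ≠ 0) (n : ℕ) :
    sigmaOne L M n = ∑ c ∈ n.divisors, (1 : DirichletCharacter ℂ L) ((n / c : ℕ) : ZMod L) * (c : ℂ) *
      ∑ d ∈ (Nat.gcd M c).divisors, (d : ℂ) * (ArithmeticFunction.moebius (M / d) : ℂ) := by
  have : NeZero M := ⟨hM⟩
  have hc : (1 : DirichletCharacter ℂ M).conductor = 1 := DirichletCharacter.conductor_one
  simp [sigmaOne, sigma, hc, dirichletCharacter_apply_of_eq_one hc]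

/-- The weights in the decomposition of the Eisenstein series into dilates of level one. -/
def weight (M : ℕ) (x : ℕ × ℕ) : ℝ :=
  ArithmeticFunction.moebius x.1 * ArithmeticFunction.moebius (M / x.2) * x.2 ^ 2

/-- The factorizations of `n` that count are `(d c) (l k)` with `c k = n / (l d)`. -/
lemma sum_divisorsAntidiagonal_dvd {n l d : ℕ} (hl : 0 < l) (hd : 0 < d) :
    ∑ x ∈ n.divisorsAntidiagonal, (if l ∣ x.2 then if d ∣ x.1 then (x.1 : ℂ) else 0 else 0)
      = if l * d ∣ n then (d : ℂ) * (ArithmeticFunction.sigma 1 (n / (l * d)) : ℂ) else 0 := by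
  by_cases h : l * d ∣ n
  · obtain ⟨k, rfl⟩ := h
    rw [if_pos (dvd_mul_right _ _), Nat.mul_div_cancel_left _ (by positivity),
      ArithmeticFunction.sigma_one_apply, Nat.cast_sum, Finset.mul_sum,
      ← Nat.sum_divisorsAntidiagonal (f := fun c _ => (d : ℂ) * (c : ℂ))]
    simp_rw [← ite_and]
    rw [← Finset.sum_filter]
    symm
    refine Finset.sum_nbij' (fun x => (d * x.1, l * x.2)) (fun x => (x.1 / d, x.2 / l)) ?_ ?_ ?_ ?_ ?_
    · intro x hx
      simp only [Nat.mem_divisorsAntidiagonal, Finset.mem_filter] at hx ⊢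
      refine ⟨⟨by rw [← hx.1]; ring, by have := hx.2; positivity⟩, dvd_mul_right _ _, dvd_mul_right _ _⟩
    · rintro ⟨a, b⟩ hx
      simp only [Nat.mem_divisorsAntidiagonal, Finset.mem_filter] at hx ⊢
      obtain ⟨⟨h1, h2⟩, ⟨b', rfl⟩, ⟨a', rfl⟩⟩ := hx
      rw [Nat.mul_div_cancel_left _ hl, Nat.mul_div_cancel_left _ hd]
      refine ⟨?_, right_ne_zero_of_mul h2⟩
      refine Nat.eq_of_mul_eq_mul_left (Nat.mul_pos hl hd) ?_
      rw [← h1]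
      ring
    · rintro ⟨a, b⟩ -
      simp [Nat.mul_div_cancel_left _ hl, Nat.mul_div_cancel_left _ hd]
    · rintro ⟨a, b⟩ hx
      simp only [Finset.mem_filter] at hx
      simp [Nat.mul_div_cancel' hx.2.1, Nat.mul_div_cancel' hx.2.2]
    · intro x _
      push_cast
      rfl
  · rw [if_neg h]
    refine Finset.sum_eq_zero fun x hx => ?_
    rw [Nat.mem_divisorsAntidiagonal] at hx
    split_ifs with h1 h2
    · exact absurd (by rw [← hx.1, mul_comm]; exact mul_dvd_mul h2 h1) h
    · rfl
    · rfl

lemma sigmaOne_eq_sum_weight {L M : ℕ} (hL : L ≠ 0) (hM : M ≠ 0) (n : ℕ) :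
    sigmaOne L M n = ∑ x ∈ L.divisors ×ˢ M.divisors, weight M x *
      if x.1 * x.2 ∣ n then (ArithmeticFunction.sigma 1 (n / (x.1 * x.2)) : ℂ) else 0 := by
  have h1 : ∀ c, ∑ d ∈ (Nat.gcd M c).divisors, (d : ℂ) * (ArithmeticFunction.moebius (M / d) : ℂ)
      = ∑ d ∈ M.divisors, if d ∣ c then (d : ℂ) * (ArithmeticFunction.moebius (M / d) : ℂ) else 0 := by
    intro c
    rw [← Finset.sum_filter]
    congr 1
    ext d
    simp [Nat.dvd_gcd_iff, hM]
  simp_rw [sigmaOne_eq hM, h1, one_apply_eq_sum_moebius hL]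
  rw [← Nat.sum_divisorsAntidiagonal (f := fun c k => (∑ d ∈ L.divisors,
    if d ∣ k then (ArithmeticFunction.moebius d : ℂ) else 0) * (c : ℂ) * ∑ d ∈ M.divisors,
      if d ∣ c then (d : ℂ) * (ArithmeticFunction.moebius (M / d) : ℂ) else 0)]
  simp_rw [Finset.sum_mul, Finset.mul_sum]
  rw [Finset.sum_comm, Finset.sum_product]
  refine Finset.sum_congr rfl fun l hl => ?_
  rw [Finset.sum_comm]
  refine Finset.sum_congr rfl fun d hd => ?_
  have h2 : (if l * d ∣ n then (ArithmeticFunction.sigma 1 (n / (l * d)) : ℂ) else 0)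
    = (d : ℂ)⁻¹ * ∑ x ∈ n.divisorsAntidiagonal, (if l ∣ x.2 then if d ∣ x.1 then (x.1 : ℂ) else 0 else 0) := by
    have : (d : ℂ) ≠ 0 := by exact_mod_cast (Nat.pos_of_mem_divisors hd).ne'
    rw [sum_divisorsAntidiagonal_dvd (Nat.pos_of_mem_divisors hl) (Nat.pos_of_mem_divisors hd)]
    split_ifs
    · field_simp
    · simp
  have hd0 : (d : ℂ) ≠ 0 := by exact_mod_cast (Nat.pos_of_mem_divisors hd).ne'
  simp only [h2, Finset.mul_sum, weight]
  refine Finset.sum_congr rfl fun x _ => ?_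
  push_cast
  split_ifs
  · field_simp
  all_goals simp

/-- Dilation of a power series. -/
lemma hasSum_dilate {a : ℕ → ℂ} {x A : ℂ} {s : ℕ} (hs : 0 < s)
    (h : HasSum (fun n => a n * (x ^ s) ^ n) A) :
    HasSum (fun n => (if s ∣ n then a (n / s) else 0) * x ^ n) A := by
  have hi : Function.Injective (fun n : ℕ => s * n) := fun _ _ h => Nat.eq_of_mul_eq_mul_left hs h
  rw [← hi.hasSum_iff]
  · convert h using 2 with n
    simp [Nat.mul_div_cancel_left _ hs, pow_mul]
  · intro n hn
    rw [if_neg, zero_mul]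
    rintro ⟨k, rfl⟩
    exact hn ⟨k, rfl⟩

/-- The constant term of the Eisenstein series in terms of the weights. -/
lemma constC2_eq {L M : ℕ} (hM : M ≠ 0) :
    constC2 L M = (Real.pi ^ 2 / 6 / M ^ 2 * ∑ x ∈ L.divisors ×ˢ M.divisors, weight M x : ℝ) := by
  have hW : ∑ x ∈ L.divisors ×ˢ M.divisors, weight M x
      = (if L = 1 then 1 else 0) * ∑ d ∈ M.divisors, (ArithmeticFunction.moebius (M / d) : ℝ) * d ^ 2 := by
    rw [Finset.sum_product]
    simp only [weight, mul_assoc]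
    simp_rw [← Finset.mul_sum]
    rw [← Finset.sum_mul]
    congr 1
    rw [← Int.cast_sum, ← ArithmeticFunction.coe_mul_zeta_apply, ArithmeticFunction.moebius_mul_coe_zeta,
      ArithmeticFunction.one_apply]
    split_ifs <;> simp
  rw [hW, constC2]
  split_ifs with h
  swap
  · simp
  have hMC : (M : ℂ) ≠ 0 := by exact_mod_cast hM
  have hz : HasSum (fun n : ℕ => 1 / (n : ℂ) ^ 2) ((Real.pi : ℂ) ^ 2 / 6) := by
    have := hasSum_zeta_two
    rw [← Complex.hasSum_ofReal] at this
    simpa using this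
  have key : HasSum (fun n : ℕ => (1 : DirichletCharacter ℂ M) (n : ZMod M) * (1 / (n : ℂ) ^ 2))
      (∑ d ∈ M.divisors, (ArithmeticFunction.moebius d : ℂ) * (1 / (d : ℂ) ^ 2 * ((Real.pi : ℂ) ^ 2 / 6))) := by
    simp_rw [one_apply_eq_sum_moebius hM, Finset.sum_mul]
    refine hasSum_sum fun d hd => ?_
    have hd0 := Nat.pos_of_mem_divisors hd
    have hi : Function.Injective (fun n : ℕ => d * n) := fun _ _ h => Nat.eq_of_mul_eq_mul_left hd0 h
    rw [← hi.hasSum_iff]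
    · refine ((hz.mul_left (1 / (d : ℂ) ^ 2)).mul_left (ArithmeticFunction.moebius d : ℂ)).congr_fun
        fun n => ?_
      simp only [Function.comp, dvd_mul_right, if_true]
      push_cast
      ring
    · intro n hn
      rw [if_neg, zero_mul]
      rintro ⟨k, rfl⟩
      exact hn ⟨k, rfl⟩
  have hL2 : LSeries (fun n => (1 : DirichletCharacter ℂ M) (n : ZMod M)) 2
      = ∑ d ∈ M.divisors, (ArithmeticFunction.moebius d : ℂ) * (1 / (d : ℂ) ^ 2 * ((Real.pi : ℂ) ^ 2 / 6)) := by
    rw [LSeries, ← key.tsum_eq]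
    refine tsum_congr fun n => ?_
    rcases eq_or_ne n 0 with rfl | hn
    · simp
    · rw [LSeries.term_of_ne_zero hn]
      norm_num [div_eq_mul_inv]
  -- The swap `d ↔ M / d` turns `∑ μ(d) / d²` into `M⁻² ∑ μ(M / d) d²`.
  rw [hL2, ← Nat.sum_div_divisors M]
  simp only [one_mul, Complex.ofReal_mul, Complex.ofReal_sum]
  push_cast
  rw [Finset.mul_sum]
  refine Finset.sum_congr rfl fun d hd => ?_
  have hd1 := Nat.dvd_of_mem_divisors hd
  have hd0 : (d : ℂ) ≠ 0 := by exact_mod_cast (Nat.pos_of_mem_divisors hd).ne'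
  rw [Nat.cast_div hd1 hd0]
  field_simp


/-! ### The logarithm of eta -/

/-- The logarithm `∑ σ₁(n) n⁻¹ qⁿ` of the inverse Euler product `∏ (1 - qⁿ)⁻¹`. -/
def eulerLog (z : ℂ) : ℂ :=
  ∑' n : ℕ, (ArithmeticFunction.sigma 1 n : ℂ) / n * Complex.exp (2 * Real.pi * Complex.I * z) ^ n

/-- The series `∑ σ₁(n) qⁿ`. -/
def sigmaSeries (z : ℂ) : ℂ :=
  ∑' n : ℕ, (ArithmeticFunction.sigma 1 n : ℂ) * Complex.exp (2 * Real.pi * Complex.I * z) ^ n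

lemma norm_exp_two_pi_I_mul (z : ℂ) :
    ‖Complex.exp (2 * Real.pi * Complex.I * z)‖ = Real.exp (-(2 * Real.pi * z.im)) := by
  rw [Complex.norm_exp]
  simp

lemma norm_sigma_le (n : ℕ) : ‖(ArithmeticFunction.sigma 1 n : ℂ)‖ ≤ (n : ℝ) ^ 2 := by
  rw [Complex.norm_natCast]
  exact_mod_cast ArithmeticFunction.sigma_le_pow_succ 1 n

lemma norm_sigma_div_le (n : ℕ) : ‖(ArithmeticFunction.sigma 1 n : ℂ) / n‖ ≤ (n : ℝ) ^ 2 := by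
  rw [norm_div, Complex.norm_natCast n]
  rcases Nat.eq_zero_or_pos n with rfl | hn
  · simp
  · exact (div_le_self (norm_nonneg _) (Nat.one_le_cast.2 hn)).trans (norm_sigma_le n)

lemma summable_sq_mul_exp {r : ℝ} (hr : 0 < r) :
    Summable fun n : ℕ => (n : ℝ) ^ 2 * Real.exp (-r) ^ n :=
  summable_pow_mul_geometric_of_norm_lt_one 2 (by
    rw [Real.norm_eq_abs, abs_of_pos (Real.exp_pos _)]
    exact Real.exp_zero ▸ Real.exp_lt_exp.2 (by linarith))

lemma norm_mul_exp_pow_le {a : ℂ} {n : ℕ} {y : ℝ} {z : ℂ} (ha : ‖a‖ ≤ (n : ℝ) ^ 2) (hz : y ≤ z.im) :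
    ‖a * Complex.exp (2 * Real.pi * Complex.I * z) ^ n‖
      ≤ (n : ℝ) ^ 2 * Real.exp (-(2 * Real.pi * y)) ^ n := by
  rw [norm_mul, norm_pow, norm_exp_two_pi_I_mul]
  gcongr

lemma hasSum_sigmaSeries {z : ℂ} (hz : 0 < z.im) :
    HasSum (fun n : ℕ => (ArithmeticFunction.sigma 1 n : ℂ)
      * Complex.exp (2 * Real.pi * Complex.I * z) ^ n) (sigmaSeries z) :=
  (Summable.of_norm_bounded (summable_sq_mul_exp (r := 2 * Real.pi * z.im) (by positivity))
    fun n => norm_mul_exp_pow_le (norm_sigma_le n) le_rfl).hasSum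

lemma hasSum_eulerLog {z : ℂ} (hz : 0 < z.im) :
    HasSum (fun n : ℕ => (ArithmeticFunction.sigma 1 n : ℂ) / n
      * Complex.exp (2 * Real.pi * Complex.I * z) ^ n) (eulerLog z) :=
  (Summable.of_norm_bounded (summable_sq_mul_exp (r := 2 * Real.pi * z.im) (by positivity))
    fun n => norm_mul_exp_pow_le (norm_sigma_div_le n) le_rfl).hasSum

lemma exists_norm_eulerLog_le : ∃ B : ℝ, ∀ z : ℂ, 1 ≤ z.im → ‖eulerLog z‖ ≤ B :=
  ⟨_, fun z hz => tsum_of_norm_bounded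
    (summable_sq_mul_exp (r := 2 * Real.pi * 1) (by positivity)).hasSum
    fun n => norm_mul_exp_pow_le (norm_sigma_div_le n) hz⟩

lemma hasDerivAt_eulerLog {z : ℂ} (hz : 0 < z.im) :
    HasDerivAt eulerLog (2 * Real.pi * Complex.I * sigmaSeries z) z := by
  -- Termwise differentiation needs a uniform majorant, which exists on the half-plane above height
  -- `Im z / 2`.
  have hu := (summable_sq_mul_exp (r := 2 * Real.pi * (z.im / 2)) (by positivity)).mul_left
    (2 * Real.pi)
  have hd : ∀ (n : ℕ) (w : ℂ), HasDerivAt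
      (fun w => (ArithmeticFunction.sigma 1 n : ℂ) / n * Complex.exp (2 * Real.pi * Complex.I * w) ^ n)
      (2 * Real.pi * Complex.I * ((ArithmeticFunction.sigma 1 n : ℂ)
        * Complex.exp (2 * Real.pi * Complex.I * w) ^ n)) w := by
    intro n w
    have h1 : HasDerivAt (fun w : ℂ => 2 * Real.pi * Complex.I * w) (2 * Real.pi * Complex.I) w := by
      simpa using (hasDerivAt_id w).const_mul (2 * Real.pi * Complex.I)
    refine ((h1.cexp.fun_pow n).const_mul ((ArithmeticFunction.sigma 1 n : ℂ) / n)).congr_deriv ?_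
    rcases n with _ | n
    · simp
    · have : ((n + 1 : ℕ) : ℂ) ≠ 0 := by exact_mod_cast Nat.succ_ne_zero n
      rw [Nat.add_sub_cancel, pow_succ]
      field_simp
  have ht : IsOpen {w : ℂ | z.im / 2 < w.im} := isOpen_lt continuous_const Complex.continuous_im
  have hc : IsPreconnected {w : ℂ | z.im / 2 < w.im} := (convex_halfSpace_im_gt _).isPreconnected
  have hmem : z ∈ {w : ℂ | z.im / 2 < w.im} := half_lt_self hz
  have := hasDerivAt_tsum_of_isPreconnected hu ht hc (fun n w _ => hd n w) (fun n w hw => by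
    rw [norm_mul]
    have : ‖(2 * Real.pi * Complex.I : ℂ)‖ = 2 * Real.pi := by simp [Real.pi_pos.le]
    rw [this]
    gcongr
    exact norm_mul_exp_pow_le (norm_sigma_le n) (le_of_lt hw)) hmem (hasSum_eulerLog hz).summable hmem
  rwa [tsum_mul_left] at this

lemma E2_eq_sigmaSeries (z : ℍ) : EisensteinSeries.E2 z = 1 - 24 * sigmaSeries z := by
  rw [EisensteinSeries.E2_eq_tsum_cexp, sigmaSeries]
  have := tsum_zero_pnat_eq_tsum_nat (hasSum_sigmaSeries z.im_pos).summable
  rw [← this]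
  simp

/-- Both functions are nonvanishing with logarithmic derivative `(π i / 12) E₂` on a connected set.
The value of `c` is immaterial: later only `log ‖c‖` enters, as an additive constant. -/
lemma exists_eta_eq : ∃ c : ℂ, c ≠ 0 ∧ ∀ z : ℂ, 0 < z.im →
    ModularForm.eta z = c * Complex.exp (Real.pi * Complex.I / 12 * z - eulerLog z) := by
  have hd : ∀ z : ℂ, 0 < z.im → HasDerivAt
      (fun z => Complex.exp (Real.pi * Complex.I / 12 * z - eulerLog z))
      (Complex.exp (Real.pi * Complex.I / 12 * z - eulerLog z)
        * (Real.pi * Complex.I / 12 - 2 * Real.pi * Complex.I * sigmaSeries z)) z := by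
    intro z hz
    have h1 : HasDerivAt (fun w : ℂ => Real.pi * Complex.I / 12 * w) (Real.pi * Complex.I / 12) z := by
      simpa using (hasDerivAt_id z).const_mul (Real.pi * Complex.I / 12)
    exact (h1.sub (hasDerivAt_eulerLog hz)).cexp
  have := (logDeriv_eqOn_iff (f := ModularForm.eta)
    (g := fun z => Complex.exp (Real.pi * Complex.I / 12 * z - eulerLog z))
    (s := {z : ℂ | 0 < z.im})
    (fun z hz => (ModularForm.differentiableAt_eta_of_mem_upperHalfPlaneSet hz).differentiableWithinAt)
    (fun z hz => (hd z hz).differentiableAt.differentiableWithinAt)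
    (isOpen_lt continuous_const Complex.continuous_im) (convex_halfSpace_im_gt _).isPreconnected
    (fun z _ => Complex.exp_ne_zero _) (fun z hz => ModularForm.eta_ne_zero hz)).1 (fun z hz => by
      rw [logDeriv_apply (fun z => Complex.exp (Real.pi * Complex.I / 12 * z - eulerLog z)), (hd z hz).deriv, mul_div_cancel_left₀ _ (Complex.exp_ne_zero _)]
      have h1 := ModularForm.logDeriv_eta_eq_E2 ⟨z, hz⟩
      rw [E2_eq_sigmaSeries] at h1
      simp only at h1
      rw [h1]
      ring)
  obtain ⟨c, hc, h⟩ := this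
  exact ⟨c, hc, fun z hz => h hz⟩

/-! ### The invariant function `log (|Δ| y⁶)` -/

/-- The logarithm of the Petersson norm `|Δ| y⁶` of the modular discriminant. -/
def logPetersson (z : ℂ) : ℝ := Real.log (‖ModularForm.eta z‖ ^ 24 * z.im ^ 6)

lemma logPetersson_smul (γ : SL(2, ℤ)) (z : ℍ) :
    logPetersson ((γ • z : ℍ) : ℂ) = logPetersson z := by
  have h := SlashInvariantFormClass.norm_petersson_smul (k := 12) (τ := z)
    (f := CuspForm.discriminant) (f' := CuspForm.discriminant)
    (g := (γ : GL (Fin 2) ℝ)) (Γ := MonoidHom.range (Matrix.SpecialLinearGroup.mapGL ℝ))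
    ⟨γ, rfl⟩
  -- The Petersson product of `Δ = η²⁴` with itself has norm `|Δ|² y¹²`, the square of the quantity
  -- wanted.
  have key : ∀ w : ℍ, ‖UpperHalfPlane.petersson 12 CuspForm.discriminant CuspForm.discriminant w‖
      = (‖ModularForm.eta w‖ ^ 24 * w.im ^ 6) ^ 2 := by
    intro w
    rw [UpperHalfPlane.petersson, CuspForm.coe_discriminant, ModularForm.discriminant]
    simp only [norm_mul, norm_pow, RCLike.norm_conj, norm_zpow, Complex.norm_real,
      Real.norm_of_nonneg w.im_pos.le]
    rw [show (12 : ℤ) = ((12 : ℕ) : ℤ) from rfl, zpow_natCast]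
    ring
  have h' : ‖UpperHalfPlane.petersson 12 CuspForm.discriminant CuspForm.discriminant (γ • z)‖
    = ‖UpperHalfPlane.petersson 12 CuspForm.discriminant CuspForm.discriminant z‖ := h
  rw [key, key] at h'
  have hp : ∀ w : ℍ, 0 ≤ ‖ModularForm.eta w‖ ^ 24 * w.im ^ 6 := fun w => by
    have := w.im_pos
    positivity
  have := (pow_left_inj₀ (hp _) (hp _) two_ne_zero).1 h'
  simp only [logPetersson, UpperHalfPlane.coe_im]
  rw [this]

lemma exists_logPetersson_eq : ∃ k : ℝ, ∀ z : ℂ, 0 < z.im →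
    logPetersson z = k - 2 * Real.pi * z.im - 24 * (eulerLog z).re + 6 * Real.log z.im := by
  obtain ⟨c, hc, h⟩ := exists_eta_eq
  refine ⟨24 * Real.log ‖c‖, fun z hz => ?_⟩
  have hc' : ‖c‖ ≠ 0 := norm_ne_zero_iff.2 hc
  rw [logPetersson, h z hz, norm_mul, Complex.norm_exp, Real.log_mul (by positivity) (by positivity),
    Real.log_pow, Real.log_pow, Real.log_mul hc' (by positivity), Real.log_exp]
  simp
  ring


/-! ### Dilates, cusps and the group `Γ₀(N)` -/

/-- `diag(s, 1) γ = γ' (g b; 0 e)` for every `γ ∈ SL₂(ℤ)` and `s ≥ 1`. -/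
lemma exists_upper_triangular (γ : SL(2, ℤ)) {s : ℕ} (hs : 0 < s) :
    ∃ (γ' : SL(2, ℤ)) (g e : ℕ) (b : ℤ), 0 < g ∧ 0 < e ∧ g ≤ s ∧
      s * γ 0 0 = γ' 0 0 * g ∧ γ 1 0 = γ' 1 0 * g ∧
      s * γ 0 1 = γ' 0 0 * b + γ' 0 1 * e ∧ γ 1 1 = γ' 1 0 * b + γ' 1 1 * e := by
  have hdet : γ 0 0 * γ 1 1 - γ 0 1 * γ 1 0 = 1 := by
    rw [← Matrix.det_fin_two]
    exact γ.det_coe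
  have hs' : (0 : ℤ) < s := by exact_mod_cast hs
  have hg : 0 < Int.gcd (s * γ 0 0) (γ 1 0) := by
    rw [Int.gcd_pos_iff]
    by_contra! h
    have h0 : γ 0 0 = 0 := (mul_eq_zero.1 h.1).resolve_left hs'.ne'
    rw [h0, h.2] at hdet
    simp at hdet
  set g := Int.gcd (s * γ 0 0) (γ 1 0) with hgdef
  obtain ⟨m, n, hmn, hm, hn⟩ := Int.exists_gcd_one hg
  -- The first column of `diag(s, 1) γ` divided by its gcd is primitive, so it is the first column
  -- of some `γ'`. The numbers `b` and `e` are then the second column of `γ'⁻¹ diag(s, 1) γ`.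
  obtain ⟨γ', h0, h1⟩ := (Int.isCoprime_iff_gcd_eq_one.2 hmn).exists_SL2_col 0
  have hdet' : γ' 0 0 * γ' 1 1 - γ' 0 1 * γ' 1 0 = 1 := by
    rw [← Matrix.det_fin_two]
    exact γ'.det_coe
  rw [← h0, ← hgdef] at hm
  rw [← h1, ← hgdef] at hn
  -- Comparison of determinants: `e g = s`, which gives `e > 0` and `g ≤ s`.
  have hge : (γ' 0 0 * γ 1 1 - γ' 1 0 * (s * γ 0 1)) * g = s := by
    linear_combination (-γ 1 1) * hm + (s * γ 0 1) * hn + s * hdet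
  have hg' : (0 : ℤ) < g := by exact_mod_cast hg
  have he : 0 < γ' 0 0 * γ 1 1 - γ' 1 0 * (s * γ 0 1) :=
    pos_of_mul_pos_left (by rw [hge]; exact hs') hg'.le
  obtain ⟨e, hee⟩ := Int.eq_ofNat_of_zero_le he.le
  rw [hee] at hge he
  refine ⟨γ', g, e, γ' 1 1 * (s * γ 0 1) - γ' 0 1 * γ 1 1, hg, by exact_mod_cast he, ?_, hm, hn,
    ?_, ?_⟩
  · have : e * g = s := by exact_mod_cast hge
    exact Nat.le_of_dvd hs ⟨e, by rw [← this, mul_comm]⟩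
  · linear_combination (-(s * γ 0 1)) * hdet' + γ' 0 1 * hee
  · linear_combination (-γ 1 1) * hdet' + γ' 1 1 * hee

section Triangular

variable {γ γ' : SL(2, ℤ)} {s g e : ℕ} {b : ℤ} {z w : ℍ}

lemma mul_denom_eq (h10 : γ 1 0 = γ' 1 0 * g) (h11 : γ 1 1 = γ' 1 0 * b + γ' 1 1 * e)
    (he : 0 < e) (hw : (w : ℂ) = (g * z + b) / e) :
    (e : ℂ) * ((γ' 1 0 : ℤ) * (w : ℂ) + (γ' 1 1 : ℤ)) = (γ 1 0 : ℤ) * (z : ℂ) + (γ 1 1 : ℤ) := by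
  have : (e : ℂ) ≠ 0 := by exact_mod_cast he.ne'
  rw [hw, h10, h11]
  push_cast
  field_simp
  ring

lemma intCast_denom_ne_zero (γ : SL(2, ℤ)) (z : ℍ) :
    ((γ 1 0 : ℤ) * (z : ℂ) + (γ 1 1 : ℤ) : ℂ) ≠ 0 := by
  have := UpperHalfPlane.denom_ne_zero γ z
  rwa [ModularGroup.denom_apply] at this

lemma coe_smul_eq_div (γ : SL(2, ℤ)) (z : ℍ) :
    ((γ • z : ℍ) : ℂ) = ((γ 0 0 : ℤ) * (z : ℂ) + (γ 0 1 : ℤ)) / ((γ 1 0 : ℤ) * (z : ℂ) + (γ 1 1 : ℤ)) := by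
  rw [UpperHalfPlane.coe_specialLinearGroup_apply]
  simp

lemma natCast_mul_smul (h00 : s * γ 0 0 = γ' 0 0 * g) (h10 : γ 1 0 = γ' 1 0 * g)
    (h01 : s * γ 0 1 = γ' 0 0 * b + γ' 0 1 * e) (h11 : γ 1 1 = γ' 1 0 * b + γ' 1 1 * e)
    (he : 0 < e) (hw : (w : ℂ) = (g * z + b) / e) :
    (s : ℂ) * ((γ • z : ℍ) : ℂ) = ((γ' • w : ℍ) : ℂ) := by
  have he' : (e : ℂ) ≠ 0 := by exact_mod_cast he.ne'
  have hd := mul_denom_eq h10 h11 he hw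
  have h1 := intCast_denom_ne_zero γ z
  have h2 := intCast_denom_ne_zero γ' w
  have hn : (e : ℂ) * ((γ' 0 0 : ℤ) * (w : ℂ) + (γ' 0 1 : ℤ))
      = s * ((γ 0 0 : ℤ) * (z : ℂ) + (γ 0 1 : ℤ)) := by
    have h00' : (s : ℂ) * (γ 0 0 : ℤ) = (γ' 0 0 : ℤ) * g := by exact_mod_cast h00
    have h01' : (s : ℂ) * (γ 0 1 : ℤ) = (γ' 0 0 : ℤ) * b + (γ' 0 1 : ℤ) * e := by exact_mod_cast h01
    rw [mul_add (s : ℂ), ← mul_assoc, h00', h01', hw]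
    field_simp
    ring
  rw [coe_smul_eq_div, coe_smul_eq_div, ← mul_div_assoc, ← hn, ← hd, mul_div_mul_left _ _ he']

end Triangular

/-- The point `(g z + b) / e`. -/
def affinePoint {g e : ℕ} (hg : 0 < g) (he : 0 < e) (b : ℤ) (z : ℍ) : ℍ :=
  ⟨(g * z + b) / e, by
    have := z.im_pos
    rw [Complex.div_natCast_im]
    simp only [Complex.add_im, Complex.mul_im, Complex.natCast_re, Complex.natCast_im,
      Complex.intCast_im, UpperHalfPlane.coe_im, zero_mul, add_zero]
    positivity⟩

lemma affinePoint_im {g e : ℕ} (hg : 0 < g) (he : 0 < e) (b : ℤ) (z : ℍ) :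
    (affinePoint hg he b z).im = g * z.im / e := by
  rw [← UpperHalfPlane.coe_im, affinePoint]
  simp [Complex.div_natCast_im]

lemma eventually_one_le_affinePoint_im {g e : ℕ} (hg : 0 < g) (he : 0 < e) (b : ℤ) :
    ∀ᶠ z : ℍ in UpperHalfPlane.atImInfty, 1 ≤ (affinePoint hg he b z).im := by
  rw [Filter.Eventually, UpperHalfPlane.atImInfty_mem]
  refine ⟨e, fun z hz => ?_⟩
  have hg1 : (1 : ℝ) ≤ g := by exact_mod_cast hg
  have he0 : (0 : ℝ) < e := by exact_mod_cast he
  have := z.im_pos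
  rw [Set.mem_ofPred_eq, affinePoint_im, le_div_iff₀ he0]
  nlinarith

lemma logPetersson_mul_smul_of_mem_Gamma0 {N s : ℕ} (hs : 0 < s) (hsN : s ∣ N) {γ : SL(2, ℤ)}
    (hγ : γ ∈ CongruenceSubgroup.Gamma0 N) (z : ℍ) :
    logPetersson (s * ((γ • z : ℍ) : ℂ)) = logPetersson (s * z) := by
  have hdet : γ 0 0 * γ 1 1 - γ 0 1 * γ 1 0 = 1 := by
    rw [← Matrix.det_fin_two]
    exact γ.det_coe
  obtain ⟨c, hc⟩ : (s : ℤ) ∣ γ 1 0 := by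
    rw [CongruenceSubgroup.Gamma0_mem, ZMod.intCast_zmod_eq_zero_iff_dvd] at hγ
    exact (Int.natCast_dvd_natCast.2 hsN).trans hγ
  -- This is the conjugate of `γ` by `diag(s, 1)`, integral because `s` divides the lower left
  -- entry.
  let γ' : SL(2, ℤ) := ⟨!![γ 0 0, s * γ 0 1; c, γ 1 1], by
    rw [Matrix.det_fin_two_of]
    linear_combination hdet + γ 0 1 * hc⟩
  have h := natCast_mul_smul (γ := γ) (γ' := γ') (s := s) (g := s) (e := 1) (b := 0) (z := z)
    (w := affinePoint hs one_pos 0 z) (by simp [γ', mul_comm]) (by simp [γ', hc, mul_comm])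
    (by simp [γ']) (by simp [γ']) one_pos rfl
  rw [h, logPetersson_smul]
  simp [affinePoint]

lemma isBigO_logPetersson (γ : SL(2, ℤ)) {s : ℕ} (hs : 0 < s) {A : ℝ} (hA : s ≤ A) :
    (fun z : ℍ => logPetersson (s * ((γ • z : ℍ) : ℂ))) =O[UpperHalfPlane.atImInfty]
      fun z : ℍ => Real.exp (A * z.im) := by
  obtain ⟨γ', g, e, b, hg, he, hgs, h00, h10, h01, h11⟩ := exists_upper_triangular γ hs
  obtain ⟨k, hk⟩ := exists_logPetersson_eq
  obtain ⟨B, hB⟩ := exists_norm_eulerLog_le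
  -- One summand for each term of the expansion of `logPetersson` at `w`, the constant, linear,
  -- `eulerLog` and logarithmic ones; all are controlled by `1 ≤ Im w ≤ exp (A y)`.
  refine Asymptotics.IsBigO.of_bound (|k| + 2 * Real.pi + 24 * B + 6) ?_
  filter_upwards [eventually_one_le_affinePoint_im hg he b] with z hz
  rw [natCast_mul_smul h00 h10 h01 h11 he (w := affinePoint hg he b z) rfl, logPetersson_smul,
    hk _ (affinePoint hg he b z).im_pos]
  set w := affinePoint hg he b z with hw
  have hB' := hB w hz
  have hre := (Complex.abs_re_le_norm (eulerLog w)).trans hB'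
  have hB0 : 0 ≤ B := (norm_nonneg _).trans hB'
  rw [UpperHalfPlane.coe_im]
  have hlog : Real.log w.im ≤ w.im := (Real.log_le_sub_one_of_pos w.im_pos).trans (by linarith)
  have hlog0 : 0 ≤ Real.log w.im := Real.log_nonneg hz
  have hexp : w.im ≤ Real.exp (A * z.im) := by
    have h1 : w.im ≤ A * z.im := by
      have hz0 := z.im_pos
      have he1 : (1 : ℝ) ≤ e := by exact_mod_cast he
      have hgA : (g : ℝ) ≤ A := le_trans (by exact_mod_cast hgs) hA
      rw [hw, affinePoint_im]
      calc (g : ℝ) * z.im / e ≤ g * z.im := div_le_self (by positivity) he1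
        _ ≤ A * z.im := by gcongr
    linarith [Real.add_one_le_exp (A * z.im)]
  have h1 : 1 ≤ Real.exp (A * z.im) := hz.trans hexp
  rw [Real.norm_eq_abs, Real.norm_eq_abs, abs_of_pos (Real.exp_pos _)]
  have hpi := Real.pi_pos
  rw [abs_le] at hre
  have hkl := neg_abs_le k
  have hkr := le_abs_self k
  have e1 : |k| ≤ |k| * Real.exp (A * z.im) := le_mul_of_one_le_right (abs_nonneg k) h1
  have e2 : B ≤ B * Real.exp (A * z.im) := le_mul_of_one_le_right hB0 h1
  have e3 : Real.pi * w.im ≤ Real.pi * Real.exp (A * z.im) := by gcongr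
  have e4 : 0 ≤ Real.pi * w.im := by positivity
  rw [abs_le]
  constructor <;> nlinarith

/-! ### The completed Eisenstein series of weight 2 -/

/-- The completed Eisenstein series `E₂ - 3 / (π y)`. -/
def E2Completed (z : ℂ) : ℂ := 1 - 24 * sigmaSeries z - (3 / (Real.pi * z.im) : ℝ)

/-- With `j = c z + d`, the identity `|j|² = j (j - 2 i c y)` makes the change of `3 / (π y)` cancel
the anomaly of `E₂`. -/
lemma E2Completed_smul (γ : SL(2, ℤ)) (z : ℍ) :
    E2Completed ((γ • z : ℍ) : ℂ)
      = ((γ 1 0 : ℤ) * (z : ℂ) + (γ 1 1 : ℤ)) ^ 2 * E2Completed z := by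
  have h := congrFun (EisensteinSeries.E2_slash_action γ) z
  have hj := intCast_denom_ne_zero γ z
  have him : (γ • z).im = z.im / Complex.normSq ((γ 1 0 : ℤ) * (z : ℂ) + (γ 1 1 : ℤ)) := by
    rw [ModularGroup.im_smul_eq_div_normSq, ModularGroup.denom_apply]
  rw [ModularForm.SL_slash_apply, Pi.sub_apply, Pi.smul_apply, EisensteinSeries.D2,
    ModularGroup.denom_apply, E2_eq_sigmaSeries, E2_eq_sigmaSeries, riemannZeta_two, smul_eq_mul] at h
  rw [E2Completed, E2Completed, UpperHalfPlane.coe_im, UpperHalfPlane.coe_im, him]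
  set j : ℂ := (γ 1 0 : ℤ) * (z : ℂ) + (γ 1 1 : ℤ) with hjdef
  have hpi : (Real.pi : ℂ) ≠ 0 := by exact_mod_cast Real.pi_ne_zero
  have hy : (z.im : ℂ) ≠ 0 := by exact_mod_cast z.im_pos.ne'
  have hconj : conj j = j - 2 * Complex.I * (γ 1 0 : ℤ) * z.im := by
    have hz : conj (z : ℂ) = z - 2 * Complex.I * z.im := by
      apply Complex.ext <;> simp
      ring
    rw [hjdef, map_add, map_mul, hz, map_intCast, map_intCast]
    ring
  have hns : ((Complex.normSq j : ℝ) : ℂ) = j * (j - 2 * Complex.I * (γ 1 0 : ℤ) * z.im) := by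
    rw [← hconj, Complex.mul_conj]
  have hns0 : (j - 2 * Complex.I * (γ 1 0 : ℤ) * z.im) ≠ 0 := by
    rw [← hconj]
    simpa using hj
  rw [zpow_neg, zpow_ofNat, ← div_eq_mul_inv, div_eq_iff (pow_ne_zero 2 hj)] at h
  rw [h]
  push_cast
  rw [hns]
  field_simp
  ring

lemma exists_norm_E2Completed_le : ∃ B : ℝ, ∀ z : ℂ, 1 ≤ z.im → ‖E2Completed z‖ ≤ B := by
  refine ⟨1 + 24 * (∑' n : ℕ, (n : ℝ) ^ 2 * Real.exp (-(2 * Real.pi * 1)) ^ n) + 1, fun z hz => ?_⟩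
  have h1 : ‖sigmaSeries z‖ ≤ _ := tsum_of_norm_bounded
    (summable_sq_mul_exp (r := 2 * Real.pi * 1) (by positivity)).hasSum
    fun n => norm_mul_exp_pow_le (norm_sigma_le n) hz
  have h2 : ‖((3 / (Real.pi * z.im) : ℝ) : ℂ)‖ ≤ 1 := by
    have := Real.pi_gt_three
    rw [Complex.norm_real, Real.norm_eq_abs, abs_of_pos (by positivity), div_le_one (by positivity)]
    nlinarith
  refine (norm_sub_le _ _).trans (add_le_add ((norm_sub_le _ _).trans ?_) h2)
  rw [norm_one, norm_mul]
  norm_num at h1 ⊢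
  linarith

/-- The automorphy factor of `γ` at `z` is `e` times that of `γ'` at `w = (g z + b) / e`, so the
expression equals `E2Completed w / e²`. -/
lemma isBigO_E2Completed (γ : SL(2, ℤ)) {s : ℕ} (hs : 0 < s) :
    (fun z : ℍ => E2Completed (s * ((γ • z : ℍ) : ℂ)) * UpperHalfPlane.denom γ z ^ (-2 : ℤ))
      =O[UpperHalfPlane.atImInfty] (1 : ℍ → ℝ) := by
  obtain ⟨γ', g, e, b, hg, he, hgs, h00, h10, h01, h11⟩ := exists_upper_triangular γ hs
  obtain ⟨B, hB⟩ := exists_norm_E2Completed_le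
  refine Asymptotics.IsBigO.of_bound B ?_
  filter_upwards [eventually_one_le_affinePoint_im hg he b] with z hz
  have he1 : (1 : ℝ) ≤ e := by exact_mod_cast he
  have he' : (e : ℂ) ≠ 0 := by exact_mod_cast he.ne'
  rw [natCast_mul_smul h00 h10 h01 h11 he (w := affinePoint hg he b z) rfl, E2Completed_smul,
    ModularGroup.denom_apply]
  set w := affinePoint hg he b z with hw
  have hd := mul_denom_eq h10 h11 he (z := z) (w := w) rfl
  have hj := intCast_denom_ne_zero γ' w
  rw [← hd]
  set j : ℂ := (γ' 1 0 : ℤ) * (w : ℂ) + (γ' 1 1 : ℤ)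
  have : j ^ 2 * E2Completed w * ((e : ℂ) * j) ^ (-2 : ℤ) = E2Completed w / e ^ 2 := by
    rw [zpow_neg, zpow_ofNat]
    field_simp
  rw [this, norm_div, norm_pow, Complex.norm_natCast, Pi.one_apply, norm_one, mul_one]
  exact (div_le_self (norm_nonneg _) (one_le_pow₀ he1)).trans (hB w hz)


/-! ### Harmonic functions of the form `A + C y + J + conj J` -/

section RealAnalytic

lemma fderiv_add_conj {J₁ J₂ : ℂ → ℂ} {a b z : ℂ} (h₁ : HasDerivAt J₁ a z) (h₂ : HasDerivAt J₂ b z)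
    (A C v : ℂ) :
    fderiv ℝ (fun w => A + C * (w.im : ℂ) + J₁ w + conj (J₂ w)) z v
      = C * (v.im : ℂ) + a * v + conj (b * v) := by
  have e1 := h₁.hasFDerivAt.restrictScalars ℝ
  have e2 := Complex.conjCLE.hasFDerivAt.comp z (h₂.hasFDerivAt.restrictScalars ℝ)
  have e3 : HasFDerivAt (fun w : ℂ => (w.im : ℂ)) (Complex.ofRealCLM.comp Complex.imCLM) z :=
    (Complex.ofRealCLM.comp Complex.imCLM).hasFDerivAt
  have e4 := (((e3.const_mul C).const_add A).add e1).add e2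
  have e5 : fderiv ℝ (fun w => A + C * (w.im : ℂ) + J₁ w + conj (J₂ w)) z = _ := e4.fderiv
  rw [e5]
  simp [mul_comm]

/-- The function `A + C y + J + conj J` on the upper half-plane. -/
def harmonicSum (A C : ℂ) (J : ℂ → ℂ) (z : ℍ) : ℂ := A + C * (z.im : ℂ) + J z + conj (J z)

variable {A C : ℂ} {J J' : ℂ → ℂ}

lemma ext_harmonicSum_eventuallyEq {z : ℂ} (hz : 0 < z.im) :
    ext (harmonicSum A C J) =ᶠ[nhds z] fun w => A + C * (w.im : ℂ) + J w + conj (J w) := by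
  filter_upwards [(isOpen_lt continuous_const Complex.continuous_im).mem_nhds hz] with w hw
  have hw' : 0 < w.im := hw
  simp [ext, harmonicSum, UpperHalfPlane.ofComplex_apply_of_im_pos hw']

lemma dx_ext_harmonicSum (hJ : ∀ z, 0 < z.im → HasDerivAt J (J' z) z) {z : ℂ} (hz : 0 < z.im) :
    dx (ext (harmonicSum A C J)) z = J' z + conj (J' z) := by
  rw [dx, (ext_harmonicSum_eventuallyEq hz).fderiv_eq, fderiv_add_conj (hJ z hz) (hJ z hz)]
  simp

lemma dy_ext_harmonicSum (hJ : ∀ z, 0 < z.im → HasDerivAt J (J' z) z) {z : ℂ} (hz : 0 < z.im) :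
    dy (ext (harmonicSum A C J)) z = C + Complex.I * J' z + conj (Complex.I * J' z) := by
  rw [dy, (ext_harmonicSum_eventuallyEq hz).fderiv_eq, fderiv_add_conj (hJ z hz) (hJ z hz)]
  simp [mul_comm]

lemma dzbar_harmonicSum (hJ : ∀ z, 0 < z.im → HasDerivAt J (J' z) z) (z : ℍ) :
    dzbar (harmonicSum A C J) z = conj (J' z) + Complex.I * C / 2 := by
  rw [dzbar, dx_ext_harmonicSum hJ z.im_pos, dy_ext_harmonicSum hJ z.im_pos, map_mul, Complex.conj_I]
  linear_combination (1 / 2 * (J' z - conj (J' z))) * Complex.I_mul_I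

lemma xi_harmonicSum (hJ : ∀ z, 0 < z.im → HasDerivAt J (J' z) z) (z : ℍ) :
    xi 0 (harmonicSum A C J) z = 2 * Complex.I * J' z + conj C := by
  rw [xi, dzbar_harmonicSum hJ]
  simp only [zpow_zero, map_add, map_div₀, map_mul, Complex.conj_conj, Complex.conj_I, map_ofNat]
  linear_combination (-conj C) * Complex.I_mul_I

lemma hypLaplacian_harmonicSum (hJ : ∀ z, 0 < z.im → HasDerivAt J (J' z) z) (z : ℍ) :
    hypLaplacian 0 (harmonicSum A C J) z = 0 := by
  have ho : IsOpen {w : ℂ | 0 < w.im} := isOpen_lt continuous_const Complex.continuous_im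
  have hJd : DifferentiableOn ℂ J {w : ℂ | 0 < w.im} := fun w hw =>
    (hJ w hw).differentiableAt.differentiableWithinAt
  have hmem : {w : ℂ | 0 < w.im} ∈ nhds (z : ℂ) := ho.mem_nhds z.im_pos
  -- `J'` coincides with `deriv J` on the open half-plane, hence is holomorphic itself.
  have hJ2 : HasDerivAt J' (deriv (deriv J) z) z := by
    refine ((hJd.deriv ho).differentiableAt hmem).hasDerivAt.congr_of_eventuallyEq ?_
    filter_upwards [hmem] with w hw using (hJ w hw).deriv.symm
  have hx : dx (ext (harmonicSum A C J)) =ᶠ[nhds (z : ℂ)]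
      fun w => 0 + 0 * (w.im : ℂ) + J' w + conj (J' w) := by
    filter_upwards [hmem] with w hw
    rw [dx_ext_harmonicSum hJ hw]
    simp
  have hy : dy (ext (harmonicSum A C J)) =ᶠ[nhds (z : ℂ)]
      fun w => C + 0 * (w.im : ℂ) + Complex.I * J' w + conj (Complex.I * J' w) := by
    filter_upwards [hmem] with w hw
    rw [dy_ext_harmonicSum hJ hw]
    simp
  have hxx : dx (dx (ext (harmonicSum A C J))) z = deriv (deriv J) z + conj (deriv (deriv J) z) := by
    rw [dx, hx.fderiv_eq, fderiv_add_conj hJ2 hJ2]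
    simp
  -- Two derivatives along `I` give the factor `i² = -1`, opposite to the pure `x` derivative.
  have hyy : dy (dy (ext (harmonicSum A C J))) z
      = -(deriv (deriv J) z + conj (deriv (deriv J) z)) := by
    rw [dy, hy.fderiv_eq, fderiv_add_conj (hJ2.const_mul Complex.I) (hJ2.const_mul Complex.I)]
    simp only [map_mul, Complex.conj_I]
    linear_combination (deriv (deriv J) z + conj (deriv (deriv J) z)) * Complex.I_mul_I
  rw [hypLaplacian, hxx, hyy]
  simp

lemma analyticOnNhd_ext_harmonicSum (hJ : ∀ z, 0 < z.im → HasDerivAt J (J' z) z) :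
    AnalyticOnNhd ℝ (ext (harmonicSum A C J)) {z : ℂ | 0 < z.im} := by
  intro z hz
  have ho : IsOpen {w : ℂ | 0 < w.im} := isOpen_lt continuous_const Complex.continuous_im
  have hJd : DifferentiableOn ℂ J {w : ℂ | 0 < w.im} := fun w hw =>
    (hJ w hw).differentiableAt.differentiableWithinAt
  have h1 : AnalyticAt ℝ J z := (hJd.analyticAt (ho.mem_nhds hz)).restrictScalars
  have h2 : AnalyticAt ℝ (fun w => conj (J w)) z :=
    (Complex.conjCLE.toContinuousLinearMap.analyticAt _).comp h1
  have h3 : AnalyticAt ℝ (fun w : ℂ => (w.im : ℂ)) z :=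
    (Complex.ofRealCLM.comp Complex.imCLM).analyticAt z
  exact (((analyticAt_const.add (analyticAt_const.mul h3)).add h1).add h2).congr
    (ext_harmonicSum_eventuallyEq hz).symm

end RealAnalytic

/-! ### Series of level `L M` as combinations of dilates -/

lemma hasSum_dilate_exp {a : ℕ → ℂ} {z A : ℂ} {s : ℕ} (hs : 0 < s)
    (h : HasSum (fun n => a n * Complex.exp (2 * Real.pi * Complex.I * (s * z)) ^ n) A) :
    HasSum (fun n => (if s ∣ n then a (n / s) else 0)
      * Complex.exp (2 * Real.pi * Complex.I * z) ^ n) A := by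
  refine hasSum_dilate hs ?_
  rw [← Complex.exp_nat_mul]
  convert h using 5
  ring

/-- The holomorphic function `∑ σ₁^{1_L,1_M}(n) n⁻¹ qⁿ`. -/
def eisensteinLog (L M : ℕ) (z : ℂ) : ℂ :=
  ∑ x ∈ L.divisors ×ˢ M.divisors, (weight M x : ℂ) / (x.1 * x.2 : ℕ) * eulerLog ((x.1 * x.2 : ℕ) * z)

/-- The holomorphic function `∑ σ₁^{1_L,1_M}(n) qⁿ`. -/
def eisensteinSeries (L M : ℕ) (z : ℂ) : ℂ :=
  ∑ x ∈ L.divisors ×ˢ M.divisors, (weight M x : ℂ) * sigmaSeries ((x.1 * x.2 : ℕ) * z)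

lemma pos_of_mem_divisors_product {L M : ℕ} {x : ℕ × ℕ} (hx : x ∈ L.divisors ×ˢ M.divisors) :
    0 < x.1 * x.2 :=
  have h := Finset.mem_product.1 hx
  Nat.mul_pos (Nat.pos_of_mem_divisors h.1) (Nat.pos_of_mem_divisors h.2)

lemma im_natCast_mul_pos {s : ℕ} {z : ℂ} (hs : 0 < s) (hz : 0 < z.im) : 0 < ((s : ℂ) * z).im := by
  simp only [Complex.mul_im, Complex.natCast_re, Complex.natCast_im, zero_mul, add_zero]
  positivity

section Series

variable {L M t : ℕ} {z : ℂ}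

lemma hasSum_eisensteinLog (hL : L ≠ 0) (hM : M ≠ 0) (hz : 0 < z.im) :
    HasSum (fun n : ℕ => sigmaOne L M n / n * Complex.exp (2 * Real.pi * Complex.I * z) ^ n)
      (eisensteinLog L M z) := by
  have h : ∀ x ∈ L.divisors ×ˢ M.divisors, _ := fun x hx =>
    (hasSum_dilate_exp (pos_of_mem_divisors_product hx)
      (hasSum_eulerLog (im_natCast_mul_pos (pos_of_mem_divisors_product hx) hz))).mul_left
        ((weight M x : ℂ) / (x.1 * x.2 : ℕ))
  refine (hasSum_sum h).congr_fun fun n => ?_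
  rw [sigmaOne_eq_sum_weight hL hM, Finset.sum_div, Finset.sum_mul]
  refine Finset.sum_congr rfl fun x hx => ?_
  have hs : ((x.1 * x.2 : ℕ) : ℂ) ≠ 0 := by exact_mod_cast (pos_of_mem_divisors_product hx).ne'
  split_ifs with hd
  · rw [Nat.cast_div hd hs]
    field_simp
  · simp

lemma hasSum_eisensteinSeries (hL : L ≠ 0) (hM : M ≠ 0) (hz : 0 < z.im) :
    HasSum (fun n : ℕ => sigmaOne L M n * Complex.exp (2 * Real.pi * Complex.I * z) ^ n)
      (eisensteinSeries L M z) := by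
  have h : ∀ x ∈ L.divisors ×ˢ M.divisors, _ := fun x hx =>
    (hasSum_dilate_exp (pos_of_mem_divisors_product hx)
      (hasSum_sigmaSeries (im_natCast_mul_pos (pos_of_mem_divisors_product hx) hz))).mul_left
        (weight M x : ℂ)
  refine (hasSum_sum h).congr_fun fun n => ?_
  rw [sigmaOne_eq_sum_weight hL hM, Finset.sum_mul]
  exact Finset.sum_congr rfl fun x hx => mul_assoc _ _ _

lemma hasDerivAt_eisensteinLog (hz : 0 < z.im) :
    HasDerivAt (eisensteinLog L M) (2 * Real.pi * Complex.I * eisensteinSeries L M z) z := by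
  have h : ∀ x ∈ L.divisors ×ˢ M.divisors, HasDerivAt
      (fun z => (weight M x : ℂ) / (x.1 * x.2 : ℕ) * eulerLog ((x.1 * x.2 : ℕ) * z))
      (2 * Real.pi * Complex.I * ((weight M x : ℂ) * sigmaSeries ((x.1 * x.2 : ℕ) * z))) z := by
    intro x hx
    have hs : ((x.1 * x.2 : ℕ) : ℂ) ≠ 0 := by exact_mod_cast (pos_of_mem_divisors_product hx).ne'
    have h1 := hasDerivAt_eulerLog (im_natCast_mul_pos (pos_of_mem_divisors_product hx) hz)
    have h2 : HasDerivAt (fun z : ℂ => ((x.1 * x.2 : ℕ) : ℂ) * z) ((x.1 * x.2 : ℕ) : ℂ) z := by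
      simpa using (hasDerivAt_id z).const_mul ((x.1 * x.2 : ℕ) : ℂ)
    refine ((h1.comp z h2).const_mul ((weight M x : ℂ) / (x.1 * x.2 : ℕ))).congr_deriv ?_
    field_simp
  have := HasDerivAt.fun_sum h
  rwa [← Finset.mul_sum] at this

/-- The holomorphic function `∑_{n ≥ 1} c₀⁺(n) qⁿ`. -/
def mockSeries (L M t : ℕ) (z : ℂ) : ℂ :=
  Real.pi / M ^ 2 * (eisensteinLog L M z - eisensteinLog L M (t * z))

/-- Since `t / n = (n / t)⁻¹`, the second half of the coefficient is that of the plain dilate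
`eisensteinLog L M (t z)`. The index 0 is kept apart because `mockCoeff L M t 0` does not come from
the logarithm. -/
lemma hasSum_mockSeries (hL : L ≠ 0) (hM : M ≠ 0) (ht : 0 < t) (hz : 0 < z.im) :
    HasSum (fun n : ℕ => if n = 0 then 0
      else mockCoeff L M t n * Complex.exp (2 * Real.pi * Complex.I * z) ^ n) (mockSeries L M t z) := by
  have h := ((hasSum_eisensteinLog hL hM hz).sub (hasSum_dilate_exp ht
    (hasSum_eisensteinLog hL hM (im_natCast_mul_pos ht hz)))).mul_left (Real.pi / M ^ 2 : ℂ)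
  refine h.congr_fun fun n => ?_
  have ht' : (t : ℂ) ≠ 0 := by exact_mod_cast ht.ne'
  split_ifs with hn hd hd
  · simp [hn]
  · simp [hn]
  · have hn' : (n : ℂ) ≠ 0 := by exact_mod_cast hn
    rw [mockCoeff, if_neg hn, if_pos hd, Nat.cast_div hd ht']
    field_simp
  · rw [mockCoeff, if_neg hn, if_neg hd]
    ring

lemma hasSum_mockCoeff (hL : L ≠ 0) (hM : M ≠ 0) (ht : 0 < t) (hz : 0 < z.im) :
    HasSum (fun n : ℕ => mockCoeff L M t n * Complex.exp (2 * Real.pi * Complex.I * z) ^ n)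
      (mockCoeff L M t 0 + mockSeries L M t z) := by
  refine ((hasSum_ite_eq 0 (mockCoeff L M t 0)).add (hasSum_mockSeries hL hM ht hz)).congr_fun
    fun n => ?_
  split_ifs with hn
  · simp [hn]
  · simp

/-- The chain rule produces the factor `t` of `E(z) - t E(t z)`. -/
lemma hasDerivAt_mockSeries (ht : 0 < t) (hz : 0 < z.im) :
    HasDerivAt (mockSeries L M t) (2 * Real.pi ^ 2 * Complex.I / M ^ 2 *
      (eisensteinSeries L M z - t * eisensteinSeries L M (t * z))) z := by
  have h2 : HasDerivAt (fun z : ℂ => (t : ℂ) * z) (t : ℂ) z := by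
    simpa using (hasDerivAt_id z).const_mul (t : ℂ)
  refine (((hasDerivAt_eisensteinLog hz).sub ((hasDerivAt_eisensteinLog
    (im_natCast_mul_pos ht hz)).comp z h2)).const_mul (Real.pi / M ^ 2 : ℂ)).congr_deriv ?_
  ring

lemma E2t_eq (hL : L ≠ 0) (hM : M ≠ 0) (ht : 0 < t) (z : ℍ) :
    E2t L M t z = (1 - t) * constC2 L M - 4 * Real.pi ^ 2 / M ^ 2 *
      (eisensteinSeries L M z - t * eisensteinSeries L M (t * z)) := by
  have h : ∀ w : ℂ, 0 < w.im → ∑' n : ℕ, sigmaOne L M (n + 1)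
      * Complex.exp (2 * Real.pi * Complex.I * w) ^ (n + 1) = eisensteinSeries L M w := by
    intro w hw
    have h1 := hasSum_eisensteinSeries hL hM hw
    rw [← h1.tsum_eq, h1.summable.tsum_eq_zero_add]
    simp [sigmaOne, sigma]
  have him : ((t : ℂ) * z).im = t * z.im := by simp
  have ht' : (t : ℂ) ≠ 0 := by exact_mod_cast ht.ne'
  have hM' : (M : ℂ) ≠ 0 := by exact_mod_cast hM
  have hy : (z.im : ℂ) ≠ 0 := by exact_mod_cast z.im_pos.ne'
  rw [E2t, E2, E2, h _ z.im_pos, h _ (im_natCast_mul_pos ht z.im_pos), him, UpperHalfPlane.coe_im]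
  push_cast
  field_simp
  ring

/-- The Eisenstein series as a combination of dilates of the completed series of level one. -/
lemma E2t_eq_sum_E2Completed (hL : L ≠ 0) (hM : M ≠ 0) (ht : 0 < t) (z : ℍ) :
    E2t L M t z = ∑ x ∈ L.divisors ×ˢ M.divisors, Real.pi ^ 2 / 6 / M ^ 2 * weight M x *
      (E2Completed ((x.1 * x.2 : ℕ) * z) - t * E2Completed ((t * (x.1 * x.2) : ℕ) * z)) := by
  rw [E2t_eq hL hM ht, constC2_eq hM, eisensteinSeries, eisensteinSeries]
  simp only [Complex.ofReal_mul, Complex.ofReal_sum, Finset.mul_sum, ← Finset.sum_sub_distrib]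
  refine Finset.sum_congr rfl fun x hx => ?_
  have hs : ((x.1 * x.2 : ℕ) : ℂ) ≠ 0 := by exact_mod_cast (pos_of_mem_divisors_product hx).ne'
  have him : ∀ n : ℕ, ((n : ℂ) * z).im = n * z.im := fun n => by simp
  have hmul : ((t * (x.1 * x.2) : ℕ) : ℂ) * z = (x.1 * x.2 : ℕ) * (t * z) := by
    push_cast
    ring
  have ht' : (t : ℂ) ≠ 0 := by exact_mod_cast ht.ne'
  have hM' : (M : ℂ) ≠ 0 := by exact_mod_cast hM
  have hy : (z.im : ℂ) ≠ 0 := by exact_mod_cast z.im_pos.ne'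
  have hpi : (Real.pi : ℂ) ≠ 0 := by exact_mod_cast Real.pi_ne_zero
  rw [E2Completed, E2Completed, him, him, hmul]
  generalize sigmaSeries _ = a, sigmaSeries _ = b
  push_cast at hs ⊢
  have := left_ne_zero_of_mul hs
  have := right_ne_zero_of_mul hs
  field_simp
  ring

/-- The harmonic Maass form with holomorphic part `∑ c₀⁺(n) qⁿ`. -/
def maassForm (L M t : ℕ) : ℍ → ℂ :=
  harmonicSum (mockCoeff L M t 0) ((1 - t) * constC2 L M) (mockSeries L M t)

lemma mockSeries_re (L M t : ℕ) (z : ℂ) : (mockSeries L M t z).re =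
    ∑ x ∈ L.divisors ×ˢ M.divisors, Real.pi / M ^ 2 * (weight M x / (x.1 * x.2 : ℕ)) *
      ((eulerLog ((x.1 * x.2 : ℕ) * z)).re - (eulerLog ((t * (x.1 * x.2) : ℕ) * z)).re) := by
  rw [mockSeries, eisensteinLog, eisensteinLog, ← Finset.sum_sub_distrib, Finset.mul_sum,
    Complex.re_sum]
  refine Finset.sum_congr rfl fun x _ => ?_
  have hmul : ((t * (x.1 * x.2) : ℕ) : ℂ) * z = (x.1 * x.2 : ℕ) * (t * z) := by
    push_cast
    ring
  rw [hmul, ← mul_sub, ← mul_assoc, ← Complex.sub_re, ← Complex.re_ofReal_mul]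
  push_cast
  rfl

/-- In each difference of `logPetersson` the `log y` terms cancel up to `6 log t`, the linear terms
add up to `C y` by `constC2_eq`, and the `eulerLog` terms give `2 Re J`. What remains is a constant,
harmless in weight 0, so the value of `c₀⁺(0)` plays no role in modularity. -/
lemma exists_maassForm_eq (hM : M ≠ 0) (ht : 0 < t) : ∃ k : ℝ, ∀ z : ℍ,
    maassForm L M t z = (k + ∑ x ∈ L.divisors ×ˢ M.divisors,
      Real.pi / 12 / M ^ 2 * (weight M x / (x.1 * x.2 : ℕ)) *
        (logPetersson ((t * (x.1 * x.2) : ℕ) * z) - logPetersson ((x.1 * x.2 : ℕ) * z)) : ℝ) := by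
  obtain ⟨k, hk⟩ := exists_logPetersson_eq
  refine ⟨Real.pi * Real.log t / M * eulerProd L * eulerProd M - ∑ x ∈ L.divisors ×ˢ M.divisors,
      Real.pi / 12 / M ^ 2 * (weight M x / (x.1 * x.2 : ℕ)) * (6 * Real.log t), fun z => ?_⟩
  have him : ∀ n : ℕ, ((n : ℂ) * z).im = n * z.im := fun n => by simp
  have key : (1 - t) * (Real.pi ^ 2 / 6 / M ^ 2 * ∑ x ∈ L.divisors ×ˢ M.divisors, weight M x) * z.im
      + 2 * (mockSeries L M t z).re = ∑ x ∈ L.divisors ×ˢ M.divisors,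
        Real.pi / 12 / M ^ 2 * (weight M x / (x.1 * x.2 : ℕ)) *
        (logPetersson ((t * (x.1 * x.2) : ℕ) * z) - logPetersson ((x.1 * x.2 : ℕ) * z))
      - ∑ x ∈ L.divisors ×ˢ M.divisors,
      Real.pi / 12 / M ^ 2 * (weight M x / (x.1 * x.2 : ℕ)) * (6 * Real.log t) := by
    rw [mockSeries_re, ← Finset.sum_sub_distrib]
    simp only [Finset.mul_sum, Finset.sum_mul, ← Finset.sum_add_distrib]
    refine Finset.sum_congr rfl fun x hx => ?_
    have hs := pos_of_mem_divisors_product hx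
    have hts : 0 < t * (x.1 * x.2) := Nat.mul_pos ht hs
    have hs' : ((x.1 * x.2 : ℕ) : ℝ) ≠ 0 := by exact_mod_cast hs.ne'
    have ht' : (t : ℝ) ≠ 0 := by exact_mod_cast ht.ne'
    have hM' : (M : ℝ) ≠ 0 := by exact_mod_cast hM
    have hy := z.im_pos.ne'
    have hlog : Real.log ((t * (x.1 * x.2) : ℕ) * z.im)
        = Real.log t + Real.log ((x.1 * x.2 : ℕ) * z.im) := by
      rw [Nat.cast_mul t, mul_assoc (t : ℝ), Real.log_mul ht' (mul_ne_zero hs' hy)]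
    rw [hk _ (im_natCast_mul_pos hs z.im_pos), hk _ (im_natCast_mul_pos hts z.im_pos), him, him, hlog]
    generalize (eulerLog _).re = a, (eulerLog _).re = b
    rw [Nat.cast_mul t]
    field_simp
    ring
  have hJ : mockSeries L M t z + conj (mockSeries L M t z)
      = ((2 * (mockSeries L M t z).re : ℝ) : ℂ) := Complex.add_conj _
  rw [maassForm, harmonicSum, mockCoeff, if_pos rfl, add_assoc, hJ, constC2_eq hM]
  norm_cast
  push_cast at key ⊢
  linear_combination key

end Series


/-! ### The conditions defining a mock modular form -/

lemma one_apply_Gamma0 {N : ℕ} {γ : SL(2, ℤ)} (hγ : γ ∈ CongruenceSubgroup.Gamma0 N) :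
    (1 : DirichletCharacter ℂ N) ((γ 1 1 : ℤ) : ZMod N) = 1 := by
  have hdet : γ 0 0 * γ 1 1 - γ 0 1 * γ 1 0 = 1 := by
    rw [← Matrix.det_fin_two]
    exact γ.det_coe
  rw [CongruenceSubgroup.Gamma0_mem] at hγ
  have h := congrArg (Int.cast : ℤ → ZMod N) hdet
  push_cast at h
  rw [hγ, mul_zero, sub_zero] at h
  exact MulChar.one_apply (IsUnit.of_mul_eq_one_right _ h)

lemma beta_zero_natCast {n : ℕ} (hn : n ≠ 0) (y : ℝ) :
    beta 0 n y = Real.exp (-4 * Real.pi * n * y) / (4 * Real.pi * n) := by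
  have hn' : (0 : ℝ) < n := by exact_mod_cast Nat.pos_of_ne_zero hn
  have h : -4 * Real.pi * n < 0 := by
    have : 0 < 4 * Real.pi * n := by positivity
    linarith
  rw [beta, if_neg hn]
  simp only [neg_zero, zpow_zero, mul_one]
  rw [integral_exp_mul_Ioi h, show -4 * Real.pi * n = -(4 * Real.pi * n) by ring, neg_div_neg_eq]

/-- This is what turns the terms `β₀(n, y) q⁻ⁿ` into those of `conj J`. -/
lemma exp_mul_q_inv_pow (z : ℍ) (n : ℕ) :
    (Real.exp (-4 * Real.pi * n * z.im) : ℂ) * q z ^ (-(n : ℤ)) = conj (q z ^ n) := by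
  rw [zpow_neg, zpow_natCast, q, ← Complex.exp_nat_mul, ← Complex.exp_neg, ← Complex.exp_conj,
    Complex.ofReal_exp, ← Complex.exp_add]
  congr 1
  apply Complex.ext <;> simp
  ring

section MaassForm

variable {L M t : ℕ}

lemma conj_sigmaOne (hL : L ≠ 0) (hM : M ≠ 0) (n : ℕ) : conj (sigmaOne L M n) = sigmaOne L M n := by
  rw [sigmaOne_eq_sum_weight hL hM, map_sum]
  refine Finset.sum_congr rfl fun x _ => ?_
  rw [map_mul, Complex.conj_ofReal]
  split_ifs <;> simp

lemma conj_mockCoeff (hL : L ≠ 0) (hM : M ≠ 0) (n : ℕ) :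
    conj (mockCoeff L M t n) = mockCoeff L M t n := by
  rw [mockCoeff]
  split_ifs
  · exact Complex.conj_ofReal _
  all_goals simp [conj_sigmaOne hL hM]

lemma conj_constC2 (hM : M ≠ 0) : conj ((1 - t) * constC2 L M) = (1 - t) * constC2 L M := by
  rw [constC2_eq hM, map_mul, Complex.conj_ofReal]
  simp

lemma xi_maassForm (hL : L ≠ 0) (hM : M ≠ 0) (ht : 0 < t) (z : ℍ) :
    xi 0 (maassForm L M t) z = E2t L M t z := by
  rw [maassForm, xi_harmonicSum (fun w hw => hasDerivAt_mockSeries ht hw), E2t_eq hL hM ht,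
    conj_constC2 hM]
  linear_combination (4 * Real.pi ^ 2 / M ^ 2 *
      (eisensteinSeries L M z - t * eisensteinSeries L M (t * z))) * Complex.I_mul_I

lemma mul_dvd_level {x : ℕ × ℕ} (hx : x ∈ L.divisors ×ˢ M.divisors) :
    t * (x.1 * x.2) ∣ t * L * M := by
  have h := Finset.mem_product.1 hx
  rw [mul_assoc]
  exact mul_dvd_mul_left t (mul_dvd_mul (Nat.dvd_of_mem_divisors h.1) (Nat.dvd_of_mem_divisors h.2))

lemma transformsLike_maassForm (hM : M ≠ 0) (ht : 0 < t) :
    TransformsLike 0 (t * L * M) 1 (maassForm L M t) := by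
  intro γ hγ z
  obtain ⟨k, hk⟩ := exists_maassForm_eq (L := L) hM ht
  rw [one_apply_Gamma0 hγ, zpow_zero, one_mul, one_mul, hk, hk]
  congr 2
  refine Finset.sum_congr rfl fun x hx => ?_
  have hs := pos_of_mem_divisors_product hx
  rw [logPetersson_mul_smul_of_mem_Gamma0 (Nat.mul_pos ht hs) (mul_dvd_level hx) hγ,
    logPetersson_mul_smul_of_mem_Gamma0 hs ((dvd_mul_left _ t).trans (mul_dvd_level hx)) hγ]

lemma hasLinearExpGrowthAtCusps_maassForm (hL : L ≠ 0) (hM : M ≠ 0) (ht : 0 < t) :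
    HasLinearExpGrowthAtCusps 0 (maassForm L M t) := by
  intro γ
  obtain ⟨k, hk⟩ := exists_maassForm_eq (L := L) hM ht
  refine ⟨(t * L * M : ℕ), ?_⟩
  have hN : 0 < t * L * M := Nat.mul_pos (Nat.mul_pos ht (Nat.pos_of_ne_zero hL)) (Nat.pos_of_ne_zero hM)
  have h : ∀ z, (maassForm L M t ∣[(0 : ℤ)] γ) z = _ := fun z => by
    rw [ModularForm.SL_slash_apply, neg_zero, zpow_zero, mul_one, hk]
  -- The form takes real values, so the estimate can be made for the real sum.
  rw [funext h, Asymptotics.isBigO_iff]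
  simp_rw [Complex.norm_real]
  rw [← Asymptotics.isBigO_iff]
  refine Asymptotics.IsBigO.add ?_ (Asymptotics.IsBigO.fun_sum fun x hx =>
    Asymptotics.IsBigO.const_mul_left (Asymptotics.IsBigO.sub ?_ ?_) _)
  · refine Asymptotics.IsBigO.of_bound |k| (Filter.Eventually.of_forall fun z => ?_)
    have hz := z.im_pos
    rw [Real.norm_eq_abs, Real.norm_eq_abs, Real.abs_exp]
    exact le_mul_of_one_le_right (abs_nonneg k) (Real.one_le_exp (by positivity))
  · exact isBigO_logPetersson γ (Nat.mul_pos ht (pos_of_mem_divisors_product hx))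
      (by exact_mod_cast Nat.le_of_dvd hN (mul_dvd_level hx))
  · exact isBigO_logPetersson γ (pos_of_mem_divisors_product hx)
      (by exact_mod_cast Nat.le_of_dvd hN ((dvd_mul_left _ t).trans (mul_dvd_level hx)))

lemma isHolomorphicAtCusps_E2t (hL : L ≠ 0) (hM : M ≠ 0) (ht : 0 < t) :
    IsHolomorphicAtCusps 2 (E2t L M t) := by
  intro γ
  have h : (E2t L M t ∣[(2 : ℤ)] γ) = fun z : ℍ => ∑ x ∈ L.divisors ×ˢ M.divisors,
      (Real.pi ^ 2 / 6 / M ^ 2 * weight M x : ℂ) *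
      (E2Completed ((x.1 * x.2 : ℕ) * ((γ • z : ℍ) : ℂ)) * UpperHalfPlane.denom γ z ^ (-2 : ℤ)
        - t * (E2Completed ((t * (x.1 * x.2) : ℕ) * ((γ • z : ℍ) : ℂ))
          * UpperHalfPlane.denom γ z ^ (-2 : ℤ))) := by
    funext z
    rw [ModularForm.SL_slash_apply, E2t_eq_sum_E2Completed hL hM ht, Finset.sum_mul]
    refine Finset.sum_congr rfl fun x _ => ?_
    ring
  rw [UpperHalfPlane.IsBoundedAtImInfty, Filter.BoundedAtFilter, h]
  refine Asymptotics.IsBigO.fun_sum fun x hx => Asymptotics.IsBigO.const_mul_left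
    (Asymptotics.IsBigO.sub ?_ (Asymptotics.IsBigO.const_mul_left ?_ _)) _
  · exact isBigO_E2Completed γ (pos_of_mem_divisors_product hx)
  · exact isBigO_E2Completed γ (Nat.mul_pos ht (pos_of_mem_divisors_product hx))

lemma isHarmonicMaassForm_maassForm (hL : L ≠ 0) (hM : M ≠ 0) (ht : 0 < t) :
    IsHarmonicMaassForm 0 (t * L * M) 1 (maassForm L M t) where
  analytic := analyticOnNhd_ext_harmonicSum fun _ hw => hasDerivAt_mockSeries ht hw
  transforms := transformsLike_maassForm hM ht
  harmonic := hypLaplacian_harmonicSum fun _ hw => hasDerivAt_mockSeries ht hw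
  growth := hasLinearExpGrowthAtCusps_maassForm hL hM ht
  xi_holomorphic := by
    rw [funext (xi_maassForm hL hM ht)]
    exact isHolomorphicAtCusps_E2t hL hM ht

lemma isHolomorphicPart_maassForm (hL : L ≠ 0) (hM : M ≠ 0) (ht : 0 < t) :
    IsHolomorphicPart 0 (maassForm L M t) (fun z => ∑' n : ℕ, mockCoeff L M t n * q z ^ n) := by
  -- The coefficients `c(n)` are read off from `h - F = -C y - conj J`, using `β₀(0, y) = -y` and
  -- `β₀(n, y) = e^{-4πny} / (4πn)`; all the numbers involved are real.
  refine ⟨0, mockCoeff L M t, fun n => if n = 0 then (1 - t) * constC2 L M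
    else -(4 * Real.pi * n * mockCoeff L M t n), fun z => ⟨?_, ?_⟩⟩
  · simpa [q] using (hasSum_mockCoeff hL hM ht z.im_pos).summable.hasSum
  · have h1 : ∑' n : ℕ, mockCoeff L M t n * q z ^ n = mockCoeff L M t 0 + mockSeries L M t z :=
      (hasSum_mockCoeff hL hM ht z.im_pos).tsum_eq
    have h2 := (hasSum_ite_eq 0 (-((1 - t) * constC2 L M * z.im))).add
      ((Complex.hasSum_conj'.2 (hasSum_mockSeries hL hM ht z.im_pos)).neg)
    have h3 : (∑' n : ℕ, mockCoeff L M t n * q z ^ n) - maassForm L M t z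
        = -((1 - t) * constC2 L M * z.im) + -conj (mockSeries L M t z) := by
      rw [h1, maassForm, harmonicSum]
      ring
    rw [h3]
    refine h2.congr_fun fun n => ?_
    beta_reduce
    have hpi : (Real.pi : ℂ) ≠ 0 := by exact_mod_cast Real.pi_ne_zero
    split_ifs with hn
    · rw [conj_constC2 hM, hn, beta, if_pos rfl, if_neg zero_ne_one]
      simp
    · have hn' : (n : ℂ) ≠ 0 := by exact_mod_cast hn
      have h4 := exp_mul_q_inv_pow z n
      rw [q] at h4
      rw [beta_zero_natCast hn, map_mul, ← h4, conj_mockCoeff hL hM, map_neg, map_mul,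
        conj_mockCoeff hL hM, q]
      push_cast
      simp only [map_mul, Complex.conj_ofReal, map_natCast, map_ofNat]
      field_simp
      ring

end MaassForm

end MockEis

end

theorem theorem1p2 (L M t : ℕ) (hL : 1 ≤ L) (hM : 1 ≤ M) (ht : 1 ≤ t) :
    (∀ z : UpperHalfPlane,
      Summable (fun n : ℕ => MockEis.mockCoeff L M t n * MockEis.q z ^ n)) ∧
    MockEis.IsMockModularForm 0 (t * L * M) (1 : DirichletCharacter ℂ (t * L * M))
      (fun z => ∑' n : ℕ, MockEis.mockCoeff L M t n * MockEis.q z ^ n)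
      (MockEis.E2t L M t) := by
  have hL' := Nat.one_le_iff_ne_zero.1 hL
  have hM' := Nat.one_le_iff_ne_zero.1 hM
  exact ⟨fun z => (MockEis.hasSum_mockCoeff hL' hM' ht z.im_pos).summable,
    MockEis.maassForm L M t, MockEis.isHarmonicMaassForm_maassForm hL' hM' ht,
    MockEis.isHolomorphicPart_maassForm hL' hM' ht, MockEis.xi_maassForm hL' hM' ht⟩
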